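/- Let $k\ge 1$ be an odd integer, $n$ an integer with $n>2k$, $c_{n,k}=\frac1n\binom nk$, $\kappa\in\mathbb R$, and let $k<q<q^*(k)$, where $q^*(k)=\frac{(n+2)k}{n-2k}$. For $\gamma>0$, let $v(\cdot,\gamma)$ denote a solution of $$(r^{n-k}(v')^k)'+r^{n-1}\left(rv'+\kappa v+c_{n,k}^{-1}|v|^{q-1}v\right)=0\ \text{ in }(0,\infty),\qquad v(0)=\gamma,\quad v'(0)=0,$$ that is, a function $v\in C^1([0,\infty))$ such that $r^{n-k}(v')^k$ is differentiable on $(0,\infty)$ and the equation and initial conditions hold. Then: (1) For every $N\in\mathbb N$ there exists $\gamma_N>0$ such that, for any $\gamma>\gamma_N$, every solution $v(\cdot,\gamma)$ has more than $N$ isolated zeros in $(0,\infty)$. (2) For every fixed $N\ge 1$, the $N$-th zero of $v(\cdot,\gamma)$ tends to $0$ as $\gamma\to\infty$. That is, for every $\varepsilon>0$ there is $\Gamma>0$ such that, for any $\gamma>\Gamma$, every solution $v(\cdot,\gamma)$ has an isolated zero $z\in(0,\varepsilon)$ with exactly $N$ zeros in $(0,z]$. -/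

import Mathlib

noncomputable section

/-- The constant `c_{n,k} = (1/n) * binom n k` of the radial `k`-Hessian operator. -/
def hessianConst (n k : ℕ) : ℝ := (n.choose k : ℝ) / (n : ℝ)

/-- The critical exponent `q^*(k)` of the `k`-Hessian operator in dimension `n`:
`(n+2)k/(n-2k)` if `k < n/2`, and `∞` otherwise. -/
def criticalExponent (n k : ℕ) : EReal :=
  if 2 * k < n then
    (((((n : ℝ) + 2) * (k : ℝ)) / ((n : ℝ) - 2 * (k : ℝ)) : ℝ) : EReal)
  else ⊤

/-- `v` is a global solution of the radial profile problem
`(r^{n-k} (v')^k)' + r^{n-1} (r v' + κ v + c_{n,k}⁻¹ |v|^{q-1} v) = 0` in `(0,∞)`,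
`v(0) = γ`, `v'(0) = 0`.

Only the restriction of `v` to `[0,∞)` matters. The function `v` is `C¹` on `[0,∞)` and
`r^{n-k} (v')^k` is differentiable on `(0,∞)` (hence `C¹` there, by the equation). Every solution
of class `C²((0,∞)) ∩ C¹([0,∞))` is a solution in this sense. For `k = 1` the two classes
agree. For odd `k ≥ 3` a solution is not twice differentiable at a critical point where
`κ v + c_{n,k}⁻¹ |v|^{q-1} v ≠ 0`, since `(v')^k` has a nonzero derivative there. -/
structure IsRadialProfile (n k : ℕ) (q κ γ : ℝ) (v : ℝ → ℝ) : Prop where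
  contDiffOn : ContDiffOn ℝ 1 v (Set.Ici 0)
  initial_value : v 0 = γ
  initial_slope : HasDerivWithinAt v 0 (Set.Ici 0) 0
  equation : ∀ r : ℝ, 0 < r →
    HasDerivAt (fun ρ : ℝ => ρ ^ (n - k) * (deriv v ρ) ^ k)
      (-(r ^ (n - 1) *
        (r * deriv v r + κ * v r + (hessianConst n k)⁻¹ * |v r| ^ (q - 1) * v r))) r

/-- `r` is an isolated zero of `v` in `(0,∞)`. -/
def IsIsolatedZero (v : ℝ → ℝ) (r : ℝ) : Prop :=
  0 < r ∧ v r = 0 ∧ ∀ᶠ s in nhdsWithin r {r}ᶜ, v s ≠ 0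

/-- `z` is the `N`-th zero of `v` in `(0,∞)`: it is an isolated zero, and `v` has exactly `N`
zeros in `(0,z]`. There is at most one such `z`; it is the `N`-th smallest zero, and also the
`N`-th smallest isolated zero. -/
def IsNthZero (v : ℝ → ℝ) (N : ℕ) (z : ℝ) : Prop :=
  IsIsolatedZero v z ∧ {r : ℝ | 0 < r ∧ r ≤ z ∧ v r = 0}.encard = (N : ℕ∞)

end

/-! The length scale `γ^{-(q-k)/(2k)}` and the amplitude `γ` turn the problem into
`(r^{n-k} (w')^k)' + r^{n-1} (ε (r w' + κ w) + C |w|^{q-1} w) = 0`, `w(0) = 1`, with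
`ε = γ^{1-q} → 0`, and send a fixed bounded interval to one of length tending to `0`. It is therefore
enough to find, for small `ε`, any prescribed number of zeros of `w` on a bounded interval and to see
that all zeros there are simple; the first assertion follows from the second one for `N + 1`.

* The energy of the rescaled problem is nonincreasing, which bounds `w` and `w'` uniformly in
  `ε ∈ [0,1]` (`exists_energy_bound`, `exists_local_bound`). Hence solutions with `ε → 0` converge
  in `C¹` on compact subsets of `(0,∞)` to a solution of the equation with `ε = 0`
  (`exists_limit_profile`). The limit is taken along ultrafilters, which spares the choice of
  subsequences. No uniqueness theorem for the limit problem is needed.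
* For the limit problem, subcriticality of `q` makes the Pohozaev function
  `k/(k+1) r^{n-k+1} (w')^{k+1} + C r^n |w|^{q+1}/(q+1) + (n-2k)/(k+1) r^{n-k} (w')^k w`
  nondecreasing and positive (`IsScaledProfile.pohozaev_pos`). In particular `w` and `w'` have no
  common zero. A solution of one sign near infinity would be monotone there and decay like
  `r^{-2k/(q-k)}`, and the Pohozaev function would be arbitrarily small at suitable points, again by
  subcriticality (`IsScaledSolution.exists_neg`). So the limit changes sign infinitely often.
* By convergence, the rescaled solutions inherit any finite number of sign changes and the
  simplicity of the zeros up to the last of them; zeros are then counted in `exists_isNthZero`.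

For `k > 1` the slope `p = w'` need not be differentiable, whereas `p^k` is. Slopes are therefore
handled through `p^k` and the `C¹` function `|p^k|^{(k+1)/k} = p^{k+1}`
(`hasDerivAt_pow_succ_of_pow`). -/

open Set Filter Topology

/-! ### Calculus preliminaries -/

lemma monotoneOn_of_hasDerivAt_nonneg {f f' : ℝ → ℝ} {D : Set ℝ} (hD : Convex ℝ D)
    (hf : ∀ r ∈ D, HasDerivAt f (f' r) r) (hf' : ∀ r ∈ D, 0 ≤ f' r) : MonotoneOn f D := by
  refine monotoneOn_of_deriv_nonneg hD (fun r hr => (hf r hr).continuousAt.continuousWithinAt)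
    (fun r hr => (hf r (interior_subset hr)).differentiableAt.differentiableWithinAt) fun r hr => ?_
  rw [(hf r (interior_subset hr)).deriv]
  exact hf' r (interior_subset hr)

lemma antitoneOn_of_hasDerivAt_nonpos {f f' : ℝ → ℝ} {D : Set ℝ} (hD : Convex ℝ D)
    (hf : ∀ r ∈ D, HasDerivAt f (f' r) r) (hf' : ∀ r ∈ D, f' r ≤ 0) : AntitoneOn f D := by
  have := monotoneOn_of_hasDerivAt_nonneg hD (fun r hr => (hf r hr).neg)
    (fun r hr => neg_nonneg.2 (hf' r hr))
  exact fun x hx y hy hxy => neg_le_neg_iff.1 (this hx hy hxy)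

lemma le_of_tendsto_zero_of_hasDerivAt_nonneg {f f' : ℝ → ℝ} {L S : ℝ}
    (hf : ∀ r ∈ Ioo 0 S, HasDerivAt f (f' r) r) (hf' : ∀ r ∈ Ioo 0 S, 0 ≤ f' r)
    (hL : Tendsto f (𝓝[>] 0) (𝓝 L)) {r : ℝ} (hr : r ∈ Ioo 0 S) : L ≤ f r := by
  have hm := monotoneOn_of_hasDerivAt_nonneg (convex_Ioo 0 S) hf hf'
  refine le_of_tendsto hL ?_
  filter_upwards [Ioo_mem_nhdsGT hr.1] with s hs
  exact hm ⟨hs.1, hs.2.trans hr.2⟩ hr hs.2.le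

/-- The chain rule in the form which makes `|w|^{q+1} / (q+1)` a primitive of `|w|^{q-1} w w'`. -/
lemma hasDerivAt_abs_rpow_add_one {q : ℝ} (hq : 0 < q) {w : ℝ → ℝ} {w' r : ℝ}
    (hw : HasDerivAt w w' r) :
    HasDerivAt (fun s => |w s| ^ (q + 1)) ((q + 1) * |w r| ^ (q - 1) * w r * w') r := by
  have h := (hasDerivAt_abs_rpow (w r) (p := q + 1) (by linarith)).comp r hw
  rw [show q + 1 - 2 = q - 1 by ring] at h
  exact h

/-- `p^{k+1}` is differentiable wherever `p^k` is, even where `p` is not: it is the `C¹` function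
`y ↦ |y|^{(k+1)/k}` of `y = p^k`. -/
lemma hasDerivAt_pow_succ_of_pow {k : ℕ} (hk : Odd k) {p : ℝ → ℝ} {y r : ℝ}
    (h : HasDerivAt (fun s => p s ^ k) y r) :
    HasDerivAt (fun s => p s ^ (k + 1)) (((k : ℝ) + 1) / k * p r * y) r := by
  have hk0 : (0 : ℝ) < k := by exact_mod_cast hk.pos
  have hb : 1 < ((k : ℝ) + 1) / k := by rw [lt_div_iff₀ hk0]; linarith
  have h2 := (hasDerivAt_abs_rpow (p r ^ k) hb).comp r h
  have e1 : (fun s => p s ^ (k + 1)) = (fun x => |x| ^ (((k : ℝ) + 1) / k)) ∘ fun s => p s ^ k := by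
    funext s
    simp only [Function.comp]
    rw [abs_pow, ← Real.rpow_natCast |p s| k, ← Real.rpow_mul (abs_nonneg _),
      mul_div_cancel₀ _ hk0.ne', ← (hk.add_one).pow_abs (p s)]
    exact_mod_cast (Real.rpow_natCast |p s| (k + 1)).symm
  rw [e1]
  refine h2.congr_deriv ?_
  rcases eq_or_ne (p r) 0 with h0 | h0
  · simp [h0, hk.pos.ne']
  · have ha : 0 < |p r| := abs_pos.2 h0
    have : |p r ^ k| ^ (((k : ℝ) + 1) / k - 2) * p r ^ k = p r := by
      have hs : p r ^ k = |p r| ^ k * SignType.sign (p r) := by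
        conv_lhs => rw [← abs_mul_sign (p r), mul_pow]
        rcases lt_or_gt_of_ne h0 with h | h <;> simp [h, hk.neg_one_pow]
      rw [abs_pow]
      conv_lhs => rw [hs]
      rw [← mul_assoc, ← Real.rpow_natCast, ← Real.rpow_mul ha.le, ← Real.rpow_add ha,
        show (k : ℝ) * (((k : ℝ) + 1) / k - 2) + k = 1 by field_simp; ring, Real.rpow_one,
        abs_mul_sign]
    rw [mul_assoc _ _ (p r ^ k), this]

/-! ### The rescaled problem -/

/-- The term `ε (r p + κ w) + C |w|^{q-1} w` of the rescaled equation. -/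
noncomputable def radialForce (q C κ ε r w p : ℝ) : ℝ := ε * (r * p + κ * w) + C * |w| ^ (q - 1) * w

/-- The rescaled equation `(r^{n-k} p^k)' + r^{n-1} (ε (r p + κ w) + C |w|^{q-1} w) = 0`
on `(0,∞)`, where `p` is the derivative of `w`. -/
structure IsScaledSolution (n k : ℕ) (q C κ ε : ℝ) (w p : ℝ → ℝ) : Prop where
  hasDerivAt : ∀ r, 0 < r → HasDerivAt w (p r) r
  flux : ∀ r, 0 < r → HasDerivAt (fun s => s ^ (n - k) * p s ^ k)
    (-(r ^ (n - 1) * radialForce q C κ ε r (w r) (p r))) r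

/-- A solution of the rescaled equation with `w = 1` and `w' = 0` at the origin, both in the sense
of right limits. -/
structure IsScaledProfile (n k : ℕ) (q C κ ε : ℝ) (w p : ℝ → ℝ) : Prop
    extends IsScaledSolution n k q C κ ε w p where
  tendsto_one : Tendsto w (𝓝[>] 0) (𝓝 1)
  tendsto_zero : Tendsto p (𝓝[>] 0) (𝓝 0)

section
variable {n k : ℕ} {q C κ ε : ℝ} {w p : ℝ → ℝ}

lemma IsScaledSolution.hasDerivAt_slope_pow (h : IsScaledSolution n k q C κ ε w p) (hk : 1 ≤ k)
    (hn : k < n) {r : ℝ} (hr : 0 < r) :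
    HasDerivAt (fun s => p s ^ k)
      (-(r ^ (k - 1) * radialForce q C κ ε r (w r) (p r)) - ((n : ℝ) - k) / r * p r ^ k) r := by
  have h1 := (h.flux r hr).div (hasDerivAt_pow (n - k) r) (pow_pos hr _).ne'
  have e : (fun s => p s ^ k) =ᶠ[𝓝 r]
      ((fun s => s ^ (n - k) * p s ^ k) / fun s => s ^ (n - k)) := by
    filter_upwards [lt_mem_nhds hr] with s hs
    have : s ^ (n - k) ≠ 0 := (pow_pos hs _).ne'
    simp only [Pi.div_apply]
    field_simp
  refine (h1.congr_of_eventuallyEq e).congr_deriv ?_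
  obtain ⟨K, rfl⟩ : ∃ K, k = K + 1 := ⟨k - 1, by omega⟩
  obtain ⟨d, rfl⟩ : ∃ d, n = (K + 1) + (d + 1) := ⟨n - (K + 1) - 1, by omega⟩
  have e1 : K + 1 + (d + 1) - (K + 1) = d + 1 := by omega
  have e2 : K + 1 + (d + 1) - 1 = K + (d + 1) := by omega
  rw [e1, e2]
  simp only [Nat.add_sub_cancel]
  push_cast
  field_simp
  ring

/-- The energy `k/(k+1) w'^{k+1} / r^{k-1} + ε κ w²/2 + C |w|^{q+1}/(q+1)`. -/
noncomputable def radialEnergy (k : ℕ) (q C κ ε : ℝ) (w p : ℝ → ℝ) (r : ℝ) : ℝ :=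
  (k : ℝ) / (k + 1) * (p r ^ (k + 1) / r ^ (k - 1)) + ε * κ * w r ^ 2 / 2 +
    C * |w r| ^ (q + 1) / (q + 1)

lemma IsScaledSolution.hasDerivAt_radialEnergy (h : IsScaledSolution n k q C κ ε w p) (hk : Odd k)
    (hn : k < n) (hq : 0 < q) {r : ℝ} (hr : 0 < r) :
    HasDerivAt (radialEnergy k q C κ ε w p)
      (-(((n : ℝ) - k + k * (k - 1) / (k + 1)) * (p r ^ (k + 1) / r ^ k) + ε * r * p r ^ 2)) r := by
  have h1 := hasDerivAt_pow_succ_of_pow hk (h.hasDerivAt_slope_pow hk.pos hn hr)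
  have hw := h.hasDerivAt r hr
  have h2 := (((h1.div (hasDerivAt_pow (k - 1) r) (pow_pos hr _).ne').const_mul
    ((k : ℝ) / (k + 1))).add (((hw.pow 2).const_mul (ε * κ)).div_const 2)).add
    (((hasDerivAt_abs_rpow_add_one hq hw).const_mul C).div_const (q + 1))
  refine h2.congr_deriv ?_
  have hq1 : q + 1 ≠ 0 := by linarith
  simp only [radialForce]
  generalize |w r| ^ (q - 1) = A
  generalize p r = P
  generalize w r = W
  obtain ⟨K, rfl⟩ : ∃ K, k = K + 1 := ⟨k - 1, by have := hk.pos; omega⟩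
  rcases K with _ | K
  · norm_num
    field_simp
    ring
  · simp only [Nat.add_sub_cancel]
    push_cast
    have : (K : ℝ) + 1 + 1 + 1 ≠ 0 := by positivity
    have : (K : ℝ) + 1 + 1 ≠ 0 := by positivity
    field_simp
    ring

end

/-! ### Uniform bounds for the rescaled problem -/

lemma continuous_radialForce {q : ℝ} (hq : 1 < q) (C κ : ℝ) :
    Continuous fun z : ℝ × ℝ × ℝ × ℝ => radialForce q C κ z.1 z.2.1 z.2.2.1 z.2.2.2 := by
  unfold radialForce
  have : Continuous fun z : ℝ × ℝ × ℝ × ℝ => |z.2.2.1| ^ (q - 1) :=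
    Continuous.rpow_const (by fun_prop) fun _ => Or.inr (by linarith)
  fun_prop

section
variable {n k : ℕ} {q C κ ε : ℝ} {w p : ℝ → ℝ}

/-- A bound on the forcing term bounds the flux by integration from the origin. -/
lemma IsScaledProfile.abs_slope_pow_le (h : IsScaledProfile n k q C κ ε w p) (hk : Odd k)
    (hn : k < n) {S G : ℝ} (hG : ∀ r ∈ Ioo 0 S, |radialForce q C κ ε r (w r) (p r)| ≤ G)
    {r : ℝ} (hr : r ∈ Ioo 0 S) : |p r| ^ k ≤ G * r ^ k := by
  have hn1 : (1 : ℝ) ≤ n := by exact_mod_cast (show 1 ≤ n by omega)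
  have hid : Tendsto (fun s : ℝ => s) (𝓝[>] 0) (𝓝 0) :=
    tendsto_nhdsWithin_of_tendsto_nhds tendsto_id
  have hflux : Tendsto (fun s => s ^ (n - k) * p s ^ k) (𝓝[>] 0) (𝓝 0) := by
    have := (hid.pow (n - k)).mul (h.tendsto_zero.pow k)
    simpa [hk.pos.ne', (show n - k ≠ 0 by omega)] using this
  have hpow : Tendsto (fun s => G * s ^ n) (𝓝[>] 0) (𝓝 0) := by
    have := (hid.pow n).const_mul G
    simpa [(show n ≠ 0 by omega)] using this
  have hmain : ∀ x : ℝ, |x| = 1 → 0 ≤ G * r ^ n + x * (r ^ (n - k) * p r ^ k) := by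
    intro x hx
    refine le_of_tendsto_zero_of_hasDerivAt_nonneg (S := S)
      (f := fun s => G * s ^ n + x * (s ^ (n - k) * p s ^ k))
      (fun s hs => ((hasDerivAt_pow n s).const_mul G).add ((h.flux s hs.1).const_mul x)) ?_ ?_ hr
    · intro s hs
      have h1 := hG s hs
      have h2 : x * radialForce q C κ ε s (w s) (p s) ≤ G := by
        refine (le_abs_self _).trans ?_
        rw [abs_mul, hx, one_mul]
        exact h1
      have h3 : G ≤ G * n := le_mul_of_one_le_right ((abs_nonneg _).trans h1) hn1
      have h4 : 0 < s ^ (n - 1) := pow_pos hs.1 _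
      nlinarith
    · simpa using hpow.add (hflux.const_mul x)
  have h1 := hmain 1 (by simp)
  have h2 := hmain (-1) (by simp)
  have h3 : 0 < r ^ (n - k) := pow_pos hr.1 _
  have h4 : r ^ n = r ^ (n - k) * r ^ k := by rw [← pow_add]; congr 1; omega
  rw [← abs_pow, abs_le]
  rw [h4] at h1 h2
  constructor <;> refine le_of_mul_le_mul_left ?_ h3 <;> linarith

lemma IsScaledProfile.tendsto_radialEnergy (h : IsScaledProfile n k q C κ ε w p) (hk : Odd k)
    (hn : k < n) (hq : 1 < q) :
    Tendsto (radialEnergy k q C κ ε w p) (𝓝[>] 0) (𝓝 (ε * κ / 2 + C / (q + 1))) := by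
  have hid : Tendsto (fun s : ℝ => s) (𝓝[>] 0) (𝓝 0) :=
    tendsto_nhdsWithin_of_tendsto_nhds tendsto_id
  have hF : Tendsto (fun s => |radialForce q C κ ε s (w s) (p s)|) (𝓝[>] 0)
      (𝓝 |radialForce q C κ ε 0 1 0|) :=
    (((continuous_radialForce hq C κ).tendsto (ε, 0, 1, 0)).comp
      (tendsto_const_nhds.prodMk_nhds (hid.prodMk_nhds
        (h.tendsto_one.prodMk_nhds h.tendsto_zero)))).abs
  have hF' := hF.eventually_le_const (lt_add_one _)
  set G := |radialForce q C κ ε 0 1 0| + 1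
  obtain ⟨S, hS, hSG⟩ := mem_nhdsGT_iff_exists_Ioo_subset.1 hF'
  have hS0 : (0 : ℝ) < S := hS
  have hquot : Tendsto (fun s => p s ^ (k + 1) / s ^ (k - 1)) (𝓝[>] 0) (𝓝 0) := by
    have hb : Tendsto (fun s => |p s| * G * s) (𝓝[>] 0) (𝓝 0) := by
      simpa using (h.tendsto_zero.abs.mul_const G).mul hid
    refine tendsto_of_tendsto_of_tendsto_of_le_of_le' tendsto_const_nhds hb ?_ ?_
    · filter_upwards [self_mem_nhdsWithin] with s hs
      exact div_nonneg (hk.add_one.pow_nonneg _) (pow_nonneg (le_of_lt hs) _)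
    · filter_upwards [Ioo_mem_nhdsGT hS0] with s hs
      have h1 := h.abs_slope_pow_le hk hn (fun r hr => hSG hr) hs
      rw [div_le_iff₀ (pow_pos hs.1 _), ← hk.add_one.pow_abs, pow_succ]
      have h2 : s * s ^ (k - 1) = s ^ k := by
        rw [← pow_succ']; congr 1; have := hk.pos; omega
      calc |p s| ^ k * |p s| ≤ G * s ^ k * |p s| := by gcongr
        _ = |p s| * G * s * s ^ (k - 1) := by rw [mul_assoc _ s, h2]; ring
  have h1 := ((hquot.const_mul ((k : ℝ) / (k + 1))).add
    (((h.tendsto_one.pow 2).const_mul (ε * κ)).div_const 2)).add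
    (((h.tendsto_one.abs.rpow_const (Or.inr (show 0 ≤ q + 1 by linarith))).const_mul C).div_const
      (q + 1))
  unfold radialEnergy
  simpa using h1

lemma IsScaledProfile.radialEnergy_le (h : IsScaledProfile n k q C κ ε w p) (hk : Odd k)
    (hn : k < n) (hq : 1 < q) (hε : 0 ≤ ε) {r : ℝ} (hr : 0 < r) :
    radialEnergy k q C κ ε w p r ≤ ε * κ / 2 + C / (q + 1) := by
  refine neg_le_neg_iff.1 (le_of_tendsto_zero_of_hasDerivAt_nonneg (S := r + 1)
    (fun s hs => (h.hasDerivAt_radialEnergy hk hn (by linarith) hs.1).neg) ?_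
    (h.tendsto_radialEnergy hk hn hq).neg ⟨hr, by linarith⟩)
  intro s hs
  have h1 : 0 ≤ p s ^ (k + 1) := hk.add_one.pow_nonneg _
  have h2 : (0 : ℝ) ≤ (n : ℝ) - k := sub_nonneg.2 (by exact_mod_cast hn.le)
  have h3 : (0 : ℝ) ≤ (k : ℝ) - 1 := sub_nonneg.2 (by exact_mod_cast hk.pos)
  have h4 := hs.1
  rw [neg_neg]
  positivity

/-- The energy bounds a solution globally and its slope locally, uniformly in `ε ∈ [0,1]`. The
exponent `q + 1 > 2` absorbs the quadratic term of the energy, whose sign is that of `κ`. -/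
lemma exists_energy_bound (n : ℕ) (hk : Odd k) (hn : k < n) (hq : 1 < q) (hC : 0 < C) (κ : ℝ) :
    ∃ M : ℝ, 0 < M ∧ ∀ ε ∈ Icc (0 : ℝ) 1, ∀ w p, IsScaledProfile n k q C κ ε w p → ∀ r, 0 < r →
      |w r| ≤ M ∧ p r ^ (k + 1) ≤ M * r ^ (k - 1) := by
  set c := C / (q + 1) with hc
  have hc0 : 0 < c := by positivity
  obtain ⟨M, hM1, hM⟩ : ∃ M : ℝ, 1 ≤ M ∧ ∀ x, M < x → |κ| + c < c * x ^ (q - 1) := by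
    have h1 := (tendsto_rpow_atTop (show 0 < q - 1 by linarith)).const_mul_atTop hc0
    obtain ⟨M, hM⟩ := (h1.eventually_gt_atTop (|κ| + c)).exists_forall_of_atTop
    exact ⟨max M 1, le_max_right _ _, fun x hx => hM x ((le_max_left _ _).trans hx.le)⟩
  have hk0 : (0 : ℝ) < k := by exact_mod_cast hk.pos
  set T := ((k : ℝ) + 1) / k * (|κ| + c + |κ| * M ^ 2)
  have hT : 0 ≤ T := by positivity
  refine ⟨M + T, by linarith, fun ε hε w p h r hr => ?_⟩
  have hE := h.radialEnergy_le hk hn hq hε.1 hr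
  have hkin : 0 ≤ p r ^ (k + 1) / r ^ (k - 1) :=
    div_nonneg (hk.add_one.pow_nonneg _) (pow_nonneg hr.le _)
  have hkin' : 0 ≤ (k : ℝ) / (k + 1) * (p r ^ (k + 1) / r ^ (k - 1)) := by positivity
  have hεκ : |ε * κ| ≤ |κ| := by
    rw [abs_mul, abs_of_nonneg hε.1]
    exact mul_le_of_le_one_left (abs_nonneg _) hε.2
  obtain ⟨hκ1, hκ2⟩ := abs_le.1 hεκ
  have hE' : (k : ℝ) / (k + 1) * (p r ^ (k + 1) / r ^ (k - 1)) + c * |w r| ^ (q + 1) ≤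
      |κ| / 2 + c + |κ| * |w r| ^ 2 / 2 := by
    have e : c * |w r| ^ (q + 1) = C * |w r| ^ (q + 1) / (q + 1) := by rw [hc]; ring
    have h1 : -(|κ| * w r ^ 2) ≤ ε * κ * w r ^ 2 := by nlinarith [sq_nonneg (w r)]
    have h2 : 0 ≤ |κ| := abs_nonneg _
    rw [e, sq_abs]
    unfold radialEnergy at hE
    linarith
  have hw : |w r| ≤ M := by
    by_contra! hlt
    have h1 := hM _ hlt
    have h2 : 1 < |w r| := hM1.trans_lt hlt
    have h3 : |w r| ^ (q + 1) = |w r| ^ (q - 1) * |w r| ^ 2 := by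
      rw [← Real.rpow_natCast, ← Real.rpow_add (by linarith)]
      congr 1; push_cast; ring
    rw [h3] at hE'
    have h4 : 1 < |w r| ^ 2 := one_lt_pow₀ h2 two_ne_zero
    have h5 : (|κ| + c) * |w r| ^ 2 < c * |w r| ^ (q - 1) * |w r| ^ 2 := by gcongr
    nlinarith [mul_nonneg (abs_nonneg κ) (sub_pos.2 h4).le, mul_pos hc0 (sub_pos.2 h4)]
  refine ⟨hw.trans (by linarith), ?_⟩
  rw [← div_le_iff₀ (pow_pos hr _)]
  have h1 : |w r| ^ 2 ≤ M ^ 2 := by gcongr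
  have h2 : 0 ≤ c * |w r| ^ (q + 1) := by positivity
  have h3 : (k : ℝ) / (k + 1) * (p r ^ (k + 1) / r ^ (k - 1)) ≤ |κ| + c + |κ| * M ^ 2 := by
    nlinarith [abs_nonneg κ, sq_nonneg M]
  have h4 : p r ^ (k + 1) / r ^ (k - 1) =
      ((k : ℝ) + 1) / k * ((k : ℝ) / (k + 1) * (p r ^ (k + 1) / r ^ (k - 1))) := by
    field_simp
  rw [h4]
  calc _ ≤ T := mul_le_mul_of_nonneg_left h3 (by positivity)
    _ ≤ M + T := by linarith

lemma exists_local_bound (n : ℕ) (hk : Odd k) (hn : k < n) (hq : 1 < q) (hC : 0 < C) (κ S : ℝ) :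
    ∃ B : ℝ, 0 < B ∧ ∀ ε ∈ Icc (0 : ℝ) 1, ∀ w p, IsScaledProfile n k q C κ ε w p →
      ∀ r ∈ Ioo 0 S, |w r| ≤ B ∧ |p r| ≤ B ∧ |radialForce q C κ ε r (w r) (p r)| ≤ B := by
  obtain ⟨M, hM0, hM⟩ := exists_energy_bound n hk hn hq hC κ
  rcases le_or_gt S 0 with hS | hS
  · exact ⟨1, one_pos, fun _ _ _ _ _ r hr => absurd (hr.1.trans hr.2) (not_lt.2 hS)⟩
  set B := 1 + M * S ^ (k - 1) with hB
  have hp : ∀ ε ∈ Icc (0 : ℝ) 1, ∀ w p, IsScaledProfile n k q C κ ε w p →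
      ∀ r ∈ Ioo 0 S, |p r| ≤ B := by
    intro ε hε w p h r hr
    have h1 := (hM ε hε w p h r hr.1).2
    have h2 : M * r ^ (k - 1) ≤ M * S ^ (k - 1) := by
      have := hr.1.le
      have := hr.2.le
      gcongr
    rcases le_total |p r| 1 with h3 | h3
    · have : 0 ≤ M * S ^ (k - 1) := by positivity
      linarith
    · have h4 : |p r| ≤ |p r| ^ (k + 1) := le_self_pow₀ h3 (by omega)
      rw [hk.add_one.pow_abs] at h4
      linarith
  have hcpt : IsCompact (Icc (0 : ℝ) 1 ×ˢ Icc 0 S ×ˢ Icc (-M) M ×ˢ Icc (-B) B) :=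
    isCompact_Icc.prod (isCompact_Icc.prod (isCompact_Icc.prod isCompact_Icc))
  obtain ⟨G, hG⟩ := hcpt.exists_bound_of_continuousOn (continuous_radialForce hq C κ).continuousOn
  refine ⟨max M (max B G), lt_max_of_lt_left hM0, fun ε hε w p h r hr => ?_⟩
  have h1 := (hM ε hε w p h r hr.1).1
  have h2 := hp ε hε w p h r hr
  have h3 := hG (ε, r, w r, p r) ⟨hε, ⟨hr.1.le, hr.2.le⟩, abs_le.1 h1, abs_le.1 h2⟩
  exact ⟨h1.trans (le_max_left _ _), h2.trans ((le_max_left _ _).trans (le_max_right _ _)),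
    h3.trans ((le_max_right _ _).trans (le_max_right _ _))⟩

end

/-! ### Compactness of the rescaled solutions -/

lemma Ultrafilter.exists_tendsto_of_abs_le {ι : Type*} (l : Ultrafilter ι) {f : ι → ℝ} {B : ℝ}
    (h : ∀ᶠ j in (l : Filter ι), |f j| ≤ B) : ∃ L, Tendsto f l (𝓝 L) := by
  obtain ⟨x, -, hx⟩ := (isCompact_Icc (a := -B) (b := B)).ultrafilter_le_nhds' (l.map f)
    (show _ from h.mono fun j hj => abs_le.1 hj)
  exact ⟨x, hx⟩

lemma tendsto_prod_nhds_of_hasDerivAt_bound {ι : Type*} {l : Filter ι} {f f' : ι → ℝ → ℝ}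
    {S B F x : ℝ}
    (hf : ∀ᶠ j in l, ∀ r ∈ Ioo 0 S, HasDerivAt (f j) (f' j r) r ∧ |f' j r| ≤ B)
    (hx : x ∈ Ioo 0 S) (hF : Tendsto (fun j => f j x) l (𝓝 F)) :
    Tendsto (fun z : ι × ℝ => f z.1 z.2) (l ×ˢ 𝓝 x) (𝓝 F) := by
  have h1 : Tendsto (fun z : ι × ℝ => f z.1 x) (l ×ˢ 𝓝 x) (𝓝 F) := hF.comp tendsto_fst
  have h2 : Tendsto (fun z : ι × ℝ => f z.1 z.2 - f z.1 x) (l ×ˢ 𝓝 x) (𝓝 0) := by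
    have hb : Tendsto (fun z : ι × ℝ => B * |z.2 - x|) (l ×ˢ 𝓝 x) (𝓝 0) := by
      have : Tendsto (fun y : ℝ => B * |y - x|) (𝓝 x) (𝓝 0) := by
        have : Continuous fun y : ℝ => B * |y - x| := by fun_prop
        simpa using this.tendsto x
      exact this.comp tendsto_snd
    refine squeeze_zero_norm' ?_ hb
    filter_upwards [hf.prod_mk (Ioo_mem_nhds hx.1 hx.2)] with z hz
    exact Convex.norm_image_sub_le_of_norm_hasDerivWithin_le
      (fun r hr => (hz.1 r hr).1.hasDerivWithinAt) (fun r hr => (hz.1 r hr).2)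
      (convex_Ioo 0 S) hx hz.2
  simpa using h2.add h1

lemma exists_continuous_leftInverse_pow {k : ℕ} (hk : Odd k) :
    ∃ g : ℝ → ℝ, Continuous g ∧ ∀ x, g (x ^ k) = x := by
  have hs : Function.Surjective fun x : ℝ => x ^ k :=
    (continuous_pow k).surjective (tendsto_pow_atTop hk.pos.ne') <| by
      simpa [Function.comp_def, hk.neg_pow] using tendsto_neg_atTop_atBot.comp
        ((tendsto_pow_atTop (α := ℝ) hk.pos.ne').comp tendsto_neg_atBot_atTop)
  let e := (hk.strictMono_pow (R := ℝ)).orderIsoOfSurjective _ hs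
  exact ⟨e.symm, e.symm.continuous, fun x => e.symm_apply_apply x⟩

/-- Along an ultrafilter with `ε → 0`, the rescaled solutions and their slopes converge locally
uniformly on `(0,∞)` to a solution of the equation with `ε = 0`. Local uniform convergence is
expressed as convergence along `l ×ˢ 𝓝 x` for each `x`. -/
theorem exists_limit_profile {ι : Type*} (l : Ultrafilter ι) {n k : ℕ} {q C : ℝ} (hk : Odd k)
    (hn : k < n) (hq : 1 < q) (hC : 0 < C) (κ : ℝ) {ε : ι → ℝ} {w p : ι → ℝ → ℝ}
    (hε : Tendsto ε l (𝓝 0)) (hε1 : ∀ᶠ j in (l : Filter ι), ε j ∈ Icc (0 : ℝ) 1)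
    (h : ∀ᶠ j in (l : Filter ι), IsScaledProfile n k q C κ (ε j) (w j) (p j)) :
    ∃ W Q : ℝ → ℝ, IsScaledProfile n k q C κ 0 W Q ∧
      (∀ x, 0 < x → Tendsto (fun z : ι × ℝ => w z.1 z.2) (↑l ×ˢ 𝓝 x) (𝓝 (W x))) ∧
      (∀ x, 0 < x → Tendsto (fun z : ι × ℝ => p z.1 z.2) (↑l ×ˢ 𝓝 x) (𝓝 (Q x))) ∧
      ∃ δ > 0, ∀ᶠ j in (l : Filter ι), ∀ r ∈ Ioo 0 δ, 1 / 2 ≤ w j r := by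
  have hbound : ∀ S : ℝ, ∃ B : ℝ, 0 < B ∧ ∀ᶠ j in (l : Filter ι), ∀ r ∈ Ioo 0 S,
      |w j r| ≤ B ∧ |p j r| ≤ B ∧ |radialForce q C κ (ε j) r (w j r) (p j r)| ≤ B := by
    intro S
    obtain ⟨B, hB0, hB⟩ := exists_local_bound n hk hn hq hC κ S
    exact ⟨B, hB0, by filter_upwards [hε1, h] with j h1 h2 using hB _ h1 _ _ h2⟩
  have hexW : ∀ x, 0 < x → ∃ L, Tendsto (fun j => w j x) l (𝓝 L) := fun x hx => by
    obtain ⟨B, -, hB⟩ := hbound (x + 1)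
    exact l.exists_tendsto_of_abs_le (hB.mono fun j hj => (hj x ⟨hx, by linarith⟩).1)
  have hexQ : ∀ x, 0 < x → ∃ L, Tendsto (fun j => p j x) l (𝓝 L) := fun x hx => by
    obtain ⟨B, -, hB⟩ := hbound (x + 1)
    exact l.exists_tendsto_of_abs_le (hB.mono fun j hj => (hj x ⟨hx, by linarith⟩).2.1)
  choose! W hW using hexW
  choose! Q hQ using hexQ
  have hWc : ∀ x, 0 < x → Tendsto (fun z : ι × ℝ => w z.1 z.2) (↑l ×ˢ 𝓝 x) (𝓝 (W x)) := by
    intro x hx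
    obtain ⟨B, -, hB⟩ := hbound (x + 1)
    refine tendsto_prod_nhds_of_hasDerivAt_bound (f' := p) (S := x + 1) (B := B) ?_
      ⟨hx, by linarith⟩ (hW x hx)
    filter_upwards [hB, h] with j h1 h2 r hr
    exact ⟨h2.hasDerivAt r hr.1, (h1 r hr).2.1⟩
  have hflux : ∀ x, 0 < x → Tendsto (fun z : ι × ℝ => z.2 ^ (n - k) * p z.1 z.2 ^ k)
      (↑l ×ˢ 𝓝 x) (𝓝 (x ^ (n - k) * Q x ^ k)) := by
    intro x hx
    obtain ⟨B, hB0, hB⟩ := hbound (x + 1)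
    refine tendsto_prod_nhds_of_hasDerivAt_bound (f := fun j s => s ^ (n - k) * p j s ^ k)
      (f' := fun j r => -(r ^ (n - 1) * radialForce q C κ (ε j) r (w j r) (p j r)))
      (S := x + 1) (B := (x + 1) ^ (n - 1) * B) ?_
      ⟨hx, by linarith⟩ (((hQ x hx).pow k).const_mul _)
    filter_upwards [hB, h] with j h1 h2 r hr
    refine ⟨h2.flux r hr.1, ?_⟩
    rw [abs_neg, abs_mul, abs_of_nonneg (pow_nonneg hr.1.le _)]
    exact mul_le_mul (pow_le_pow_left₀ hr.1.le hr.2.le _) (h1 r hr).2.2 (abs_nonneg _)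
      (pow_nonneg (by linarith) _)
  have hsnd : ∀ x : ℝ, Tendsto (fun z : ι × ℝ => z.2) (↑l ×ˢ 𝓝 x) (𝓝 x) := fun x => tendsto_snd
  have hQc : ∀ x, 0 < x → Tendsto (fun z : ι × ℝ => p z.1 z.2) (↑l ×ˢ 𝓝 x) (𝓝 (Q x)) := by
    intro x hx
    obtain ⟨g, hg, hgk⟩ := exists_continuous_leftInverse_pow hk
    have hx0 : x ^ (n - k) ≠ 0 := (pow_pos hx _).ne'
    have h1 := (hg.tendsto _).comp ((hflux x hx).div ((hsnd x).pow (n - k)) hx0)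
    rw [mul_div_cancel_left₀ _ hx0, hgk] at h1
    refine h1.congr' ?_
    filter_upwards [(hsnd x).eventually (lt_mem_nhds hx)] with z hz
    simp only [Function.comp, Pi.div_apply]
    rw [mul_div_cancel_left₀ _ (pow_pos hz _).ne', hgk]
  have hprod : ∀ x, 0 < x → ∀ᶠ z : ι × ℝ in ↑l ×ˢ 𝓝 x,
      IsScaledProfile n k q C κ (ε z.1) (w z.1) (p z.1) ∧ 0 < z.2 :=
    fun x hx => h.prod_mk (lt_mem_nhds hx)
  -- uniform convergence to the initial data at the origin
  obtain ⟨B, hB0, hB⟩ := hbound 1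
  have hnear : ∀ᶠ j in (l : Filter ι), ∀ r ∈ Ioo (0 : ℝ) 1,
      |w j r - 1| ≤ B * r ∧ |p j r| ^ k ≤ B * r ^ k := by
    filter_upwards [hB, h] with j h1 h2 r hr
    refine ⟨?_, h2.abs_slope_pow_le hk hn (fun s hs => (h1 s hs).2.2) hr⟩
    have hid : Tendsto (fun s : ℝ => |r - s|) (𝓝[>] 0) (𝓝 |r|) := by
      have : Continuous fun s : ℝ => |r - s| := by fun_prop
      simpa using tendsto_nhdsWithin_of_tendsto_nhds (this.tendsto 0)
    have := le_of_tendsto_of_tendsto (h2.tendsto_one.const_sub (w j r)).abs (hid.const_mul B) (by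
      filter_upwards [Ioo_mem_nhdsGT hr.1] with s hs
      exact Convex.norm_image_sub_le_of_norm_hasDerivWithin_le
        (fun t ht => (h2.hasDerivAt t ht.1).hasDerivWithinAt) (fun t ht => (h1 t ht).2.1)
        (convex_Ioo 0 1) ⟨hs.1, hs.2.trans hr.2⟩ hr)
    rwa [abs_of_pos hr.1] at this
  have hWnear : ∀ r ∈ Ioo (0 : ℝ) 1, |W r - 1| ≤ B * r := fun r hr =>
    le_of_tendsto ((hW r hr.1).sub_const 1).abs (hnear.mono fun j hj => (hj r hr).1)
  have hQnear : ∀ r ∈ Ioo (0 : ℝ) 1, |Q r| ^ k ≤ B * r ^ k := fun r hr =>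
    le_of_tendsto ((hQ r hr.1).abs.pow k) (hnear.mono fun j hj => (hj r hr).2)
  have hid : Tendsto (fun s : ℝ => s) (𝓝[>] 0) (𝓝 0) :=
    tendsto_nhdsWithin_of_tendsto_nhds tendsto_id
  refine ⟨W, Q, ⟨⟨fun r hr => ?_, fun r hr => ?_⟩, ?_, ?_⟩, hWc, hQc, ?_⟩
  · refine hasDerivAt_of_tendstoUniformlyOnFilter (f := w) (f' := p) (g' := fun _ => Q r)
      (l := (l : Filter ι)) (tendsto_prod_filter_iff.1 (hQc r hr)) ?_ ?_
    · filter_upwards [hprod r hr] with z hz using hz.1.hasDerivAt _ hz.2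
    · filter_upwards [lt_mem_nhds hr] with y hy using hW y hy
  · refine hasDerivAt_of_tendstoUniformlyOnFilter (f := fun j s => s ^ (n - k) * p j s ^ k)
      (f' := fun j r => -(r ^ (n - 1) * radialForce q C κ (ε j) r (w j r) (p j r)))
      (g' := fun _ => -(r ^ (n - 1) * radialForce q C κ 0 r (W r) (Q r)))
      (l := (l : Filter ι)) (tendsto_prod_filter_iff.1 ?_) ?_ ?_
    · have h1 := ((continuous_radialForce hq C κ).tendsto (0, r, W r, Q r)).comp
        ((hε.comp tendsto_fst).prodMk_nhds ((hsnd r).prodMk_nhds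
          ((hWc r hr).prodMk_nhds (hQc r hr))))
      exact (((hsnd r).pow (n - 1)).mul h1).neg
    · filter_upwards [hprod r hr] with z hz using hz.1.flux _ hz.2
    · filter_upwards [lt_mem_nhds hr] with y hy using ((hQ y hy).pow k).const_mul _
  · have h1 : Tendsto (fun r => W r - 1) (𝓝[>] 0) (𝓝 0) := by
      refine squeeze_zero_norm' ?_ (by simpa using hid.const_mul B)
      filter_upwards [Ioo_mem_nhdsGT one_pos] with r hr using hWnear r hr
    simpa using h1.add_const 1
  · obtain ⟨g, hg, hgk⟩ := exists_continuous_leftInverse_pow hk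
    have h1 : Tendsto (fun r => Q r ^ k) (𝓝[>] 0) (𝓝 0) := by
      have h2 := (hid.pow k).const_mul B
      rw [zero_pow hk.pos.ne', mul_zero] at h2
      refine squeeze_zero_norm' ?_ h2
      filter_upwards [Ioo_mem_nhdsGT one_pos] with r hr
      rw [Real.norm_eq_abs, abs_pow]
      exact hQnear r hr
    have h2 := (hg.tendsto 0).comp h1
    have h3 : g 0 = 0 := by simpa [hk.pos.ne'] using hgk 0
    rw [h3] at h2
    exact h2.congr fun r => hgk _
  · refine ⟨min 1 (1 / (2 * B)), by positivity, ?_⟩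
    filter_upwards [hnear] with j hj r hr
    have h1 := (abs_le.1 (hj r ⟨hr.1, hr.2.trans_le (min_le_left _ _)⟩).1).1
    have h2 : r < 1 / (2 * B) := hr.2.trans_le (min_le_right _ _)
    rw [lt_div_iff₀ (by positivity)] at h2
    linarith

/-! ### The Pohozaev function of the limit equation -/

lemma abs_rpow_add_one_eq {q : ℝ} (hq : 1 < q) (x : ℝ) :
    |x| ^ (q + 1) = |x| ^ (q - 1) * x ^ 2 := by
  rcases eq_or_ne x 0 with rfl | hx
  · simp [Real.zero_rpow (show q + 1 ≠ 0 by linarith)]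
  · rw [← sq_abs, ← Real.rpow_natCast, ← Real.rpow_add (abs_pos.2 hx)]
    congr 1
    push_cast
    ring

/-- The Pohozaev function of the limit equation. The coefficient `(n-2k)/(k+1)` of the last term is
the one for which no multiple of `r^{n-k} p^{k+1}` remains in the derivative. -/
noncomputable def pohozaev (n k : ℕ) (q C : ℝ) (w p : ℝ → ℝ) (r : ℝ) : ℝ :=
  (k : ℝ) / (k + 1) * (r ^ (n - k + 1) * p r ^ (k + 1)) + C * (r ^ n * |w r| ^ (q + 1)) / (q + 1) +
    ((n : ℝ) - 2 * k) / (k + 1) * (r ^ (n - k) * p r ^ k * w r)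

section
variable {n k : ℕ} {q C κ : ℝ} {w p : ℝ → ℝ}

lemma IsScaledSolution.neg {ε : ℝ} (h : IsScaledSolution n k q C κ ε w p) (hk : Odd k) :
    IsScaledSolution n k q C κ ε (-w) (-p) where
  hasDerivAt r hr := (h.hasDerivAt r hr).neg
  flux r hr := by
    have e : (fun s => s ^ (n - k) * (-p) s ^ k) = -fun s => s ^ (n - k) * p s ^ k := by
      funext s
      simp [hk.neg_pow]
    rw [e]
    refine (h.flux r hr).neg.congr_deriv ?_
    simp only [radialForce, Pi.neg_apply, abs_neg]
    ring

lemma pohozaev_neg (hk : Odd k) (r : ℝ) :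
    pohozaev n k q C (-w) (-p) r = pohozaev n k q C w p r := by
  simp [pohozaev, hk.neg_pow, hk.add_one.neg_pow]

lemma IsScaledSolution.hasDerivAt_pohozaev (h : IsScaledSolution n k q C κ 0 w p) (hk : Odd k)
    (hn : k < n) (hq : 1 < q) {r : ℝ} (hr : 0 < r) :
    HasDerivAt (pohozaev n k q C w p)
      (C * (n / (q + 1) - ((n : ℝ) - 2 * k) / (k + 1)) * (r ^ (n - 1) * |w r| ^ (q + 1))) r := by
  have hw := h.hasDerivAt r hr
  have h1 := hasDerivAt_pow_succ_of_pow hk (h.hasDerivAt_slope_pow hk.pos hn hr)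
  have h2 := ((((hasDerivAt_pow (n - k + 1) r).mul h1).const_mul ((k : ℝ) / (k + 1))).add
    ((((hasDerivAt_pow n r).mul (hasDerivAt_abs_rpow_add_one (q := q) (by linarith) hw)).const_mul
      C).div_const (q + 1))).add (((h.flux r hr).mul hw).const_mul (((n : ℝ) - 2 * k) / (k + 1)))
  refine h2.congr_deriv ?_
  rw [abs_rpow_add_one_eq hq]
  have hq1 : q + 1 ≠ 0 := by linarith
  simp only [radialForce]
  generalize |w r| ^ (q - 1) = A
  generalize p r = P
  generalize w r = W
  obtain ⟨K, rfl⟩ : ∃ K, k = K + 1 := ⟨k - 1, by have := hk.pos; omega⟩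
  obtain ⟨d, rfl⟩ : ∃ d, n = (K + 1) + (d + 1) := ⟨n - (K + 1) - 1, by omega⟩
  have e1 : K + 1 + (d + 1) - (K + 1) = d + 1 := by omega
  have e2 : K + 1 + (d + 1) - 1 = K + (d + 1) := by omega
  rw [e1, e2]
  simp only [Nat.add_sub_cancel]
  push_cast
  have : (K : ℝ) + 1 + 1 ≠ 0 := by positivity
  have : (K : ℝ) + 1 ≠ 0 := by positivity
  field_simp
  ring

/-- Positivity of the coefficient in the Pohozaev identity is subcriticality of `q`. -/
lemma pohozaev_coeff_pos (hq : 1 < q)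
    (hsub : q * ((n : ℝ) - 2 * k) < ((n : ℝ) + 2) * k) :
    0 < n / (q + 1) - ((n : ℝ) - 2 * k) / (k + 1) := by
  rw [sub_pos, div_lt_div_iff₀ (by positivity) (by linarith)]
  nlinarith

lemma IsScaledProfile.monotoneOn_pohozaev (h : IsScaledProfile n k q C κ 0 w p) (hk : Odd k)
    (hn : 2 * k < n) (hq : 1 < q) (hC : 0 < C)
    (hsub : q * ((n : ℝ) - 2 * k) < ((n : ℝ) + 2) * k) :
    MonotoneOn (pohozaev n k q C w p) (Ioi 0) := by
  have hc := pohozaev_coeff_pos hq hsub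
  refine monotoneOn_of_hasDerivAt_nonneg (convex_Ioi 0)
    (fun r hr => h.hasDerivAt_pohozaev hk (by omega) hq hr) fun r hr => ?_
  have : (0 : ℝ) < r := hr
  positivity

lemma IsScaledProfile.pohozaev_pos (h : IsScaledProfile n k q C κ 0 w p) (hk : Odd k)
    (hn : 2 * k < n) (hq : 1 < q) (hC : 0 < C)
    (hsub : q * ((n : ℝ) - 2 * k) < ((n : ℝ) + 2) * k) {r : ℝ} (hr : 0 < r) :
    0 < pohozaev n k q C w p r := by
  have hc := pohozaev_coeff_pos hq hsub
  have hid : Tendsto (fun s : ℝ => s) (𝓝[>] 0) (𝓝 0) :=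
    tendsto_nhdsWithin_of_tendsto_nhds tendsto_id
  have hlim : Tendsto (pohozaev n k q C w p) (𝓝[>] 0) (𝓝 0) := by
    have h1 := ((((hid.pow (n - k + 1)).mul (h.tendsto_zero.pow (k + 1))).const_mul
      ((k : ℝ) / (k + 1))).add ((((hid.pow n).mul (h.tendsto_one.abs.rpow_const
        (Or.inr (show 0 ≤ q + 1 by linarith)))).const_mul C).div_const (q + 1))).add
      ((((hid.pow (n - k)).mul (h.tendsto_zero.pow k)).mul h.tendsto_one).const_mul
        (((n : ℝ) - 2 * k) / (k + 1)))
    unfold pohozaev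
    simpa [hk.pos.ne', show n ≠ 0 by omega] using h1
  have hnonneg : ∀ s, 0 < s → 0 ≤ pohozaev n k q C w p s := fun s hs =>
    le_of_tendsto_zero_of_hasDerivAt_nonneg (S := s + 1)
      (fun t ht => h.hasDerivAt_pohozaev hk (by omega) hq ht.1)
      (fun t ht => by have := ht.1; positivity) hlim ⟨hs, by linarith⟩
  refine (hnonneg r hr).lt_of_ne' fun h0 => ?_
  -- otherwise `pohozaev` vanishes on `(0, r)`, hence so does `w`
  obtain ⟨s, hs1, hs2⟩ := ((h.tendsto_one.eventually (lt_mem_nhds one_pos)).and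
    (Ioo_mem_nhdsGT hr)).exists
  have hz : pohozaev n k q C w p =ᶠ[𝓝 s] fun _ => 0 := by
    filter_upwards [Ioo_mem_nhds hs2.1 hs2.2] with t ht
    exact le_antisymm (h0 ▸ h.monotoneOn_pohozaev hk hn hq hC hsub ht.1 hr ht.2.le) (hnonneg t ht.1)
  have h1 := (h.hasDerivAt_pohozaev hk (by omega) hq hs2.1).unique
    ((hasDerivAt_const s (0 : ℝ)).congr_of_eventuallyEq hz)
  have h2 : 0 < |w s| := abs_pos.2 hs1.ne'
  have h3 := hs2.1
  have : 0 < C * (n / (q + 1) - ((n : ℝ) - 2 * k) / (k + 1)) * (s ^ (n - 1) * |w s| ^ (q + 1)) := by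
    positivity
  exact this.ne' h1

/-! ### Oscillation of the limit equation -/

/-- A positive decreasing solution decays like `r^{-2k/(q-k)}`: integrating the equation gives
`-w' ≥ c r w^{q/k}`, which is integrated once more. -/
lemma IsScaledSolution.exists_decay (h : IsScaledSolution n k q C κ 0 w p) (hk : Odd k)
    (hn : k < n) (hkq : (k : ℝ) < q) (hC : 0 < C) {R : ℝ} (hR : 0 < R)
    (hw : ∀ r, R ≤ r → 0 < w r) (hp : ∀ r, R ≤ r → p r < 0) :
    ∃ D : ℝ, 0 < D ∧ ∀ r, 4 * R ≤ r → w r ≤ D * r ^ (-(2 * k / (q - k))) := by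
  have hk0 : (0 : ℝ) < k := by exact_mod_cast hk.pos
  have hn0 : (0 : ℝ) < n := by exact_mod_cast (show 0 < n by omega)
  have hq0 : 0 < q := by linarith
  have hanti : AntitoneOn w (Ici R) := antitoneOn_of_hasDerivAt_nonpos (convex_Ici R)
    (fun r hr => h.hasDerivAt r (hR.trans_le hr)) fun r hr => (hp r hr).le
  have hflux : ∀ r, R ≤ r → r ^ (n - k) * p r ^ k ≤ -(C * w r ^ q * (r ^ n - R ^ n) / n) := by
    intro r hr
    have h1 : AntitoneOn (fun s => s ^ (n - k) * p s ^ k + C * w r ^ q / n * s ^ n) (Icc R r) := by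
      refine antitoneOn_of_hasDerivAt_nonpos (convex_Icc R r) (fun s hs =>
        (h.flux s (hR.trans_le hs.1)).add ((hasDerivAt_pow n s).const_mul (C * w r ^ q / n)))
        fun s hs => ?_
      have hws := hw s hs.1
      have e : |w s| ^ (q - 1) * w s = w s ^ q := by
        rw [abs_of_pos hws, ← Real.rpow_add_one hws.ne']
        congr 1
        ring
      have h2 : w r ^ q ≤ w s ^ q :=
        Real.rpow_le_rpow (hw r hr).le (hanti hs.1 hr hs.2) hq0.le
      have h3 : 0 < s ^ (n - 1) := pow_pos (hR.trans_le hs.1) _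
      have h4 : C * w r ^ q / n * (n * s ^ (n - 1)) = C * s ^ (n - 1) * w r ^ q := by field_simp
      rw [h4, radialForce, zero_mul, zero_add, mul_assoc C, e]
      have : C * s ^ (n - 1) * w r ^ q ≤ C * s ^ (n - 1) * w s ^ q := by gcongr
      linarith
    have h2 := h1 ⟨le_rfl, hr⟩ ⟨hr, le_rfl⟩ hr
    have h3 : R ^ (n - k) * p R ^ k ≤ 0 :=
      mul_nonpos_of_nonneg_of_nonpos (pow_pos hR _).le (hk.pow_neg (hp R le_rfl)).le
    have e : C * w r ^ q * (r ^ n - R ^ n) / n =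
        C * w r ^ q / n * r ^ n - C * w r ^ q / n * R ^ n := by
      ring
    dsimp only at h2
    linarith
  set c := (C / (2 * n)) ^ ((k : ℝ)⁻¹) with hc
  have hc0 : 0 < c := by positivity
  have hck : c ^ k = C / (2 * n) := Real.rpow_inv_natCast_pow (by positivity) hk.pos.ne'
  have hslope : ∀ r, 2 * R ≤ r → c * r * w r ^ (q / k) ≤ -p r := by
    intro r hr
    have hrR : R ≤ r := by linarith
    have hr0 : 0 < r := by linarith
    have hwr := hw r hrR
    have h1 := hflux r hrR
    have h2 : R ^ n ≤ r ^ n / 2 := by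
      have h3 : (2 * R) ^ n ≤ r ^ n := by gcongr
      have h4 : (2 : ℝ) ≤ 2 ^ n := le_self_pow₀ one_le_two (by omega)
      have h5 : 0 < R ^ n := by positivity
      rw [mul_pow] at h3
      nlinarith
    have h3 : C * w r ^ q * (r ^ n / 2) / n ≤ C * w r ^ q * (r ^ n - R ^ n) / n := by
      gcongr
      linarith
    have h4 : r ^ n = r ^ (n - k) * r ^ k := by rw [← pow_add]; congr 1; omega
    have h5 : C * w r ^ q * (r ^ n / 2) / n = r ^ (n - k) * (C / (2 * n) * r ^ k * w r ^ q) := by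
      rw [h4]
      field_simp
    have h6 : C / (2 * n) * r ^ k * w r ^ q ≤ (-p r) ^ k := by
      rw [hk.neg_pow]
      refine le_of_mul_le_mul_left ?_ (pow_pos hr0 (n - k))
      linarith
    refine le_of_pow_le_pow_left₀ hk.pos.ne' (neg_pos.2 (hp r hrR)).le ?_
    rw [mul_pow, mul_pow, hck, ← Real.rpow_natCast (w r ^ (q / k)), ← Real.rpow_mul hwr.le,
      div_mul_cancel₀ _ hk0.ne']
    exact h6
  set θ := (q - k) / k with hθ
  have hθ0 : 0 < θ := div_pos (by linarith) hk0
  have hpow : ∀ r, 4 * R ≤ r → θ * c / 4 * r ^ 2 ≤ w r ^ (-θ) := by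
    have hm : MonotoneOn (fun s => w s ^ (-θ) - θ * c / 2 * s ^ 2) (Ici (2 * R)) := by
      refine monotoneOn_of_hasDerivAt_nonneg (convex_Ici _) (fun s hs => ?_) ?_ (f' := fun s =>
        p s * (-θ) * w s ^ (-θ - 1) - θ * c / 2 * (2 * s))
      · have hs' : 2 * R ≤ s := hs
        have h1 := (h.hasDerivAt s (by linarith)).rpow_const (p := -θ)
          (Or.inl (hw s (by linarith)).ne')
        refine (h1.sub ((hasDerivAt_pow 2 s).const_mul (θ * c / 2))).congr_deriv ?_
        norm_num
      · intro s hs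
        have hs' : 2 * R ≤ s := hs
        have hws := hw s (by linarith)
        have h1 : c * s * w s ^ (q / k) * w s ^ (-θ - 1) ≤ -p s * w s ^ (-θ - 1) :=
          mul_le_mul_of_nonneg_right (hslope s hs') (by positivity)
        rw [mul_assoc, ← Real.rpow_add hws, show q / k + (-θ - 1) = 0 by rw [hθ]; field_simp; ring,
          Real.rpow_zero, mul_one] at h1
        nlinarith
    intro r hr
    have h1 := hm (mem_Ici.2 le_rfl) (mem_Ici.2 (show 2 * R ≤ r by linarith)) (by linarith)
    have h2 : 0 < w (2 * R) ^ (-θ) := Real.rpow_pos_of_pos (hw _ (by linarith)) _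
    have h3 : r ^ 2 / 2 ≤ r ^ 2 - (2 * R) ^ 2 := by nlinarith
    have h4 : θ * c / 2 * (r ^ 2 / 2) ≤ θ * c / 2 * (r ^ 2 - (2 * R) ^ 2) := by gcongr
    dsimp only at h1
    linarith
  refine ⟨(θ * c / 4) ^ (-θ⁻¹), by positivity, fun r hr => ?_⟩
  have hr0 : 0 < r := by linarith
  have hwr := hw r (by linarith)
  have h1 := Real.rpow_le_rpow_of_nonpos (by positivity) (hpow r hr)
    (neg_nonpos.2 (inv_pos.2 hθ0).le)
  rw [← Real.rpow_mul hwr.le, neg_mul_neg, mul_inv_cancel₀ hθ0.ne', Real.rpow_one,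
    Real.mul_rpow (by positivity) (by positivity), ← Real.rpow_natCast r,
    ← Real.rpow_mul hr0.le] at h1
  have e : ((2 : ℕ) : ℝ) * -θ⁻¹ = -(2 * k / (q - k)) := by
    rw [hθ, inv_div]
    push_cast
    ring
  rwa [e] at h1

/-- A solution along which the Pohozaev function stays away from `0` takes negative values
arbitrarily far out: a positive solution is eventually decreasing, and the decay of
`exists_decay` makes the Pohozaev function small at suitable points. -/
lemma IsScaledSolution.exists_neg (h : IsScaledSolution n k q C κ 0 w p) (hk : Odd k)
    (hn : 2 * k < n) (hkq : (k : ℝ) < q) (hC : 0 < C)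
    (hsub : q * ((n : ℝ) - 2 * k) < ((n : ℝ) + 2) * k) {R c : ℝ} (hR : 0 < R) (hc : 0 < c)
    (hP : ∀ r, R < r → c ≤ pohozaev n k q C w p r) : ∃ t, R < t ∧ w t < 0 := by
  by_contra! hw
  have hk0 : (0 : ℝ) < k := by exact_mod_cast hk.pos
  have hk1 : (1 : ℝ) ≤ k := by exact_mod_cast hk.pos
  have hq : 1 < q := by linarith
  set a : ℝ → ℝ := fun s => s ^ (n - k) * p s ^ k with ha
  have haderiv : ∀ r, R < r → HasDerivAt a (-(r ^ (n - 1) * (C * |w r| ^ (q - 1) * w r))) r := by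
    intro r hr
    refine (h.flux r (hR.trans hr)).congr_deriv ?_
    rw [radialForce, zero_mul, zero_add]
  have hanti : AntitoneOn a (Ioi R) :=
    antitoneOn_of_hasDerivAt_nonpos (convex_Ioi R) haderiv fun r hr => by
      have := hw r hr
      have : 0 < r := hR.trans hr
      have : 0 ≤ r ^ (n - 1) * (C * |w r| ^ (q - 1) * w r) := by positivity
      linarith
  have hsign : ∀ r, R < r → a r < 0 → p r < 0 := by
    intro r hr har
    have := pow_pos (hR.trans hr) (n - k)
    exact (hk.pow_neg_iff).1 (by by_contra! h0; exact absurd har (not_lt.2 (mul_nonneg this.le h0)))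
  obtain ⟨R₁, hR₁, haR₁⟩ : ∃ R₁, R < R₁ ∧ a R₁ < 0 := by
    -- a nonnegative flux makes `w` nondecreasing, so that the flux decreases at least linearly
    by_contra! ha0
    have hp0 : ∀ r, R < r → 0 ≤ p r := by
      intro r hr
      have h1 := pow_pos (hR.trans hr) (n - k)
      have h2 : 0 ≤ p r ^ k := by
        by_contra! h3
        exact absurd (ha0 r hr) (not_le.2 (mul_neg_of_pos_of_neg h1 h3))
      exact hk.pow_nonneg_iff.1 h2
    have hmono : MonotoneOn w (Ioi R) := monotoneOn_of_hasDerivAt_nonneg (convex_Ioi R)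
      (fun r hr => h.hasDerivAt r (hR.trans hr)) hp0
    obtain ⟨t, ht, hwt⟩ : ∃ t, R < t ∧ 0 < w t := by
      by_contra! hle
      have hz : ∀ r, R < r → w r = 0 := fun r hr => le_antisymm (hle r hr) (hw r hr)
      have hR1 : R < R + 1 := by linarith
      have hd := (h.hasDerivAt (R + 1) (by linarith)).unique
        ((hasDerivAt_const (R + 1) (0 : ℝ)).congr_of_eventuallyEq
          (by filter_upwards [lt_mem_nhds hR1] with s hs using hz s hs))
      have := hP (R + 1) hR1
      simp only [pohozaev, hz _ hR1, hd, abs_zero,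
        Real.zero_rpow (show q + 1 ≠ 0 by linarith)] at this
      simp at this
      linarith
    have ht0 : 0 < t := hR.trans ht
    set μ := t ^ (n - 1) * (C * w t ^ (q - 1) * w t) with hμ
    have hμ0 : 0 < μ := by positivity
    have hlin : AntitoneOn (fun s => a s + μ * s) (Ici t) := by
      refine antitoneOn_of_hasDerivAt_nonpos (convex_Ici t) (fun s hs =>
        (haderiv s (ht.trans_le hs)).add ((hasDerivAt_id s).const_mul μ)) fun s hs => ?_
      have hs' : t ≤ s := hs
      have hws : w t ≤ w s := hmono ht (ht.trans_le hs') hs'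
      have : μ ≤ s ^ (n - 1) * (C * |w s| ^ (q - 1) * w s) := by
        have hs0 : 0 < s := ht0.trans_le hs'
        have hws0 : 0 ≤ w s := hwt.le.trans hws
        rw [hμ, abs_of_nonneg hws0]
        have : 0 ≤ q - 1 := by linarith
        gcongr
      linarith
    have h1 := ha0 t ht
    have h2 : t ≤ t + (a t + 1) / μ := by
      have : 0 ≤ (a t + 1) / μ := by positivity
      linarith
    have h3 := hlin (mem_Ici.2 le_rfl) (mem_Ici.2 h2) h2
    have h4 := ha0 _ (ht.trans_le h2)
    have h5 : μ * (t + (a t + 1) / μ) = μ * t + (a t + 1) := by field_simp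
    dsimp only at h3
    linarith
  have hR₁0 : 0 < R₁ := hR.trans hR₁
  have hp : ∀ r, R₁ ≤ r → p r < 0 := fun r hr =>
    hsign r (hR₁.trans_le hr) ((hanti hR₁ (hR₁.trans_le hr) hr).trans_lt haR₁)
  have hwanti : StrictAntiOn w (Ici R₁) := by
    refine strictAntiOn_of_deriv_neg (convex_Ici R₁)
      (fun r hr => (h.hasDerivAt r (hR₁0.trans_le hr)).continuousAt.continuousWithinAt) ?_
    intro r hr
    rw [interior_Ici] at hr
    rw [(h.hasDerivAt r (hR₁0.trans hr)).deriv]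
    exact hp r (le_of_lt hr)
  have hwpos : ∀ r, R₁ ≤ r → 0 < w r := fun r hr =>
    (hw (r + 1) (by linarith)).trans_lt (hwanti hr (mem_Ici.2 (by linarith)) (by linarith))
  obtain ⟨D, hD0, hD⟩ := h.exists_decay hk (by omega) hkq hC hR₁0 hwpos hp
  set m := 2 * (k : ℝ) / (q - k) with hm
  have hm0 : 0 < m := div_pos (by linarith) (by linarith)
  have hmq : m * (q - k) = 2 * k := div_mul_cancel₀ _ (by linarith)
  set e := m * (k + 1) - ((n : ℝ) - 2 * k) with he
  have he0 : 0 < e := by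
    have : 0 < e * (q - k) := by
      have : e * (q - k) = m * (q - k) * (k + 1) - ((n : ℝ) - 2 * k) * (q - k) := by
        rw [he]; ring
      rw [this, hmq]
      nlinarith
    exact (pos_iff_pos_of_mul_pos this).2 (by linarith)
  set A : ℝ := 2 ^ (n - k + 1) * D ^ (k + 1) + C * 2 ^ n * D ^ (q + 1) / (q + 1) with hA
  have hsmall : ∀ r, 4 * R₁ ≤ r → c ≤ A * r ^ (-e) := by
    intro r hr
    have hr0 : 0 < r := by linarith
    obtain ⟨s, hs, hps⟩ := exists_hasDerivAt_eq_slope w p (show r < 2 * r by linarith)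
      (fun x hx => (h.hasDerivAt x (hr0.trans_le hx.1)).continuousAt.continuousWithinAt)
      (fun x hx => h.hasDerivAt x (hr0.trans hx.1))
    have hsR : R₁ ≤ s := by linarith [hs.1]
    have hs0 : 0 < s := hR₁0.trans_le hsR
    have hwr := hwpos r (by linarith)
    have hws := hwpos s hsR
    have hwsr : w s ≤ w r := (hwanti.antitoneOn) (mem_Ici.2 (by linarith)) hsR hs.1.le
    have hpneg := hp s hsR
    have hpb : |p s| ≤ w r / r := by
      rw [abs_of_neg hpneg, hps, ← neg_div, show 2 * r - r = r by ring]
      have := hwpos (2 * r) (by linarith)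
      refine div_le_div_of_nonneg_right ?_ hr0.le
      linarith
    have hcP := hP s (hR₁.trans_le hsR)
    have h1 : ((n : ℝ) - 2 * k) / (k + 1) * (s ^ (n - k) * p s ^ k * w s) ≤ 0 := by
      have h2 : (0 : ℝ) < (n : ℝ) - 2 * k := sub_pos.2 (by exact_mod_cast hn)
      have h3 : s ^ (n - k) * p s ^ k ≤ 0 :=
        mul_nonpos_of_nonneg_of_nonpos (by positivity) (hk.pow_neg hpneg).le
      exact mul_nonpos_of_nonneg_of_nonpos (by positivity)
        (mul_nonpos_of_nonpos_of_nonneg h3 hws.le)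
    have h2 : (k : ℝ) / (k + 1) * (s ^ (n - k + 1) * p s ^ (k + 1)) ≤
        2 ^ (n - k + 1) * D ^ (k + 1) * r ^ (-e) := by
      have h3 : (k : ℝ) / (k + 1) ≤ 1 := by rw [div_le_one (by positivity)]; linarith
      have h4 : s ^ (n - k + 1) * p s ^ (k + 1) ≤ (2 * r) ^ (n - k + 1) * (w r / r) ^ (k + 1) := by
        rw [← hk.add_one.pow_abs]
        have := hs.2.le
        exact mul_le_mul (pow_le_pow_left₀ hs0.le this _) (pow_le_pow_left₀ (abs_nonneg _) hpb _)
          (by positivity) (by positivity)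
      have h5 : 0 ≤ s ^ (n - k + 1) * p s ^ (k + 1) :=
        mul_nonneg (by positivity) (hk.add_one.pow_nonneg _)
      calc _ ≤ s ^ (n - k + 1) * p s ^ (k + 1) := mul_le_of_le_one_left h5 h3
        _ ≤ (2 * r) ^ (n - k + 1) * (w r / r) ^ (k + 1) := h4
        _ ≤ (2 * r) ^ (n - k + 1) * (D * r ^ (-m) / r) ^ (k + 1) := by
          gcongr
          exact hD r hr
        _ = 2 ^ (n - k + 1) * D ^ (k + 1) * r ^ (-e) := by
          rw [mul_pow, div_pow, mul_pow, ← Real.rpow_natCast (r ^ (-m)), ← Real.rpow_mul hr0.le]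
          have e1 : r ^ (-e) = r ^ (n - k + 1) * r ^ (-m * ((k + 1 : ℕ) : ℝ)) / r ^ (k + 1) := by
            rw [← Real.rpow_natCast r (n - k + 1), ← Real.rpow_natCast r (k + 1),
              ← Real.rpow_add hr0, ← Real.rpow_sub hr0]
            congr 1
            rw [he]
            push_cast [Nat.cast_sub (show k ≤ n by omega)]
            ring
          rw [e1]
          ring
    have h3 : C * (s ^ n * |w s| ^ (q + 1)) / (q + 1) ≤
        C * 2 ^ n * D ^ (q + 1) / (q + 1) * r ^ (-e) := by
      have h4 : |w s| ≤ D * r ^ (-m) := by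
        rw [abs_of_pos hws]
        exact hwsr.trans (hD r hr)
      have h5 : s ≤ 2 * r := hs.2.le
      calc _ ≤ C * ((2 * r) ^ n * (D * r ^ (-m)) ^ (q + 1)) / (q + 1) := by gcongr
        _ = _ := by
          rw [mul_pow, Real.mul_rpow hD0.le (by positivity), ← Real.rpow_mul hr0.le]
          have e1 : r ^ (-e) = r ^ n * r ^ (-m * (q + 1)) := by
            rw [← Real.rpow_natCast r n, ← Real.rpow_add hr0]
            congr 1
            rw [he]
            linarith
          rw [e1]
          ring
    unfold pohozaev at hcP
    rw [hA, add_mul]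
    linarith
  have hlim : Tendsto (fun r : ℝ => A * r ^ (-e)) atTop (𝓝 0) := by
    simpa using (tendsto_rpow_neg_atTop he0).const_mul A
  exact absurd (ge_of_tendsto hlim (eventually_atTop.2 ⟨_, hsmall⟩)) (not_le.2 hc)

end

section
variable {n k : ℕ} {q C κ : ℝ} {w p : ℝ → ℝ}

/-- The limit problem oscillates: the signs at a suitable increasing sequence alternate. -/
lemma IsScaledProfile.exists_alternating (h : IsScaledProfile n k q C κ 0 w p) (hk : Odd k)
    (hn : 2 * k < n) (hkq : (k : ℝ) < q) (hC : 0 < C)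
    (hsub : q * ((n : ℝ) - 2 * k) < ((n : ℝ) + 2) * k) :
    ∃ t : ℕ → ℝ, 0 < t 0 ∧ StrictMono t ∧ ∀ i, 0 < (-1) ^ i * w (t i) := by
  have hk1 : (1 : ℝ) ≤ k := by exact_mod_cast hk.pos
  have hq : 1 < q := by linarith
  have hstep : ∀ (i : ℕ) (R : ℝ), 0 < R → ∃ t, R < t ∧ 0 < (-1) ^ i * w t := by
    intro i R hR
    have hP0 := h.pohozaev_pos hk hn hq hC hsub hR
    have hP : ∀ r, R < r → pohozaev n k q C w p R ≤ pohozaev n k q C w p r := fun r hr =>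
      h.monotoneOn_pohozaev hk hn hq hC hsub hR (hR.trans hr) hr.le
    rcases Nat.even_or_odd i with hi | hi
    · obtain ⟨t, ht, hwt⟩ := (h.toIsScaledSolution.neg hk).exists_neg hk hn hkq hC hsub hR hP0
        fun r hr => (hP r hr).trans_eq (pohozaev_neg hk r).symm
      exact ⟨t, ht, by simpa [hi.neg_one_pow] using hwt⟩
    · obtain ⟨t, ht, hwt⟩ := h.toIsScaledSolution.exists_neg hk hn hkq hC hsub hR hP0 hP
      exact ⟨t, ht, by simpa [hi.neg_one_pow] using hwt⟩
  choose! f hf using hstep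
  let t : ℕ → ℝ := fun i => Nat.rec (f 0 1) (fun i x => f (i + 1) x) i
  have ht0 : ∀ i, 0 < t i := by
    intro i
    induction i with
    | zero => exact one_pos.trans (hf 0 1 one_pos).1
    | succ i ih => exact ih.trans (hf (i + 1) (t i) ih).1
  refine ⟨t, ht0 0, strictMono_nat_of_lt_succ fun i => (hf (i + 1) (t i) (ht0 i)).1, fun i => ?_⟩
  cases i with
  | zero => exact (hf 0 1 one_pos).2
  | succ i => exact (hf (i + 1) (t i) (ht0 i)).2

lemma IsScaledProfile.ne_zero_or_ne_zero (h : IsScaledProfile n k q C κ 0 w p) (hk : Odd k)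
    (hn : 2 * k < n) (hq : 1 < q) (hC : 0 < C)
    (hsub : q * ((n : ℝ) - 2 * k) < ((n : ℝ) + 2) * k) {r : ℝ} (hr : 0 < r) :
    (w r, p r) ≠ (0, 0) := by
  intro h0
  obtain ⟨h1, h2⟩ := Prod.mk.inj h0
  have := h.pohozaev_pos hk hn hq hC hsub hr
  simp [pohozaev, h1, h2, Real.zero_rpow (show q + 1 ≠ 0 by linarith)] at this

end

/-! ### Counting zeros -/

lemma Finset.exists_card_filter_le_eq (s : Finset ℝ) {N : ℕ} (hN : 1 ≤ N) (hs : N ≤ s.card) :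
    ∃ z ∈ s, (s.filter (· ≤ z)).card = N := by
  induction s using Finset.induction_on_max with
  | empty => simp at hs; omega
  | insert a s hmax ih =>
    have ha : a ∉ s := fun h => lt_irrefl _ (hmax a h)
    rw [Finset.card_insert_of_notMem ha] at hs
    rcases hs.eq_or_lt with h | h
    · refine ⟨a, Finset.mem_insert_self a s, ?_⟩
      rw [Finset.filter_true_of_mem, Finset.card_insert_of_notMem ha, h]
      intro x hx
      rcases Finset.mem_insert.1 hx with rfl | hx
      exacts [le_rfl, (hmax x hx).le]
    · obtain ⟨z, hz, hzN⟩ := ih (by omega)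
      exact ⟨z, Finset.mem_insert_of_mem hz, by
        rw [Finset.filter_insert, if_neg (not_le.2 (hmax z hz)), hzN]⟩

/-- A differentiable function with simple zeros in `(0, t N]`, none of them near the origin, and
alternating signs at `t 0 < ⋯ < t N` has an `N`-th zero. -/
lemma exists_isNthZero {v v' : ℝ → ℝ} (hv : ∀ r, 0 < r → HasDerivAt v (v' r) r) {N : ℕ}
    (hN : 1 ≤ N) {t : ℕ → ℝ} (ht0 : 0 < t 0) (ht : StrictMono t)
    (hsign : ∀ i ≤ N, 0 < (-1) ^ i * v (t i)) {δ : ℝ} (hδ : 0 < δ) (hv0 : ∀ r ∈ Ioo 0 δ, v r ≠ 0)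
    (hsimple : ∀ r ∈ Ioc 0 (t N), v r = 0 → v' r ≠ 0) : ∃ z ≤ t N, IsNthZero v N z := by
  have htpos : ∀ i, 0 < t i := fun i => ht0.trans_le (ht.monotone (Nat.zero_le i))
  set Z : Set ℝ := {r | r ∈ Ioc 0 (t N) ∧ v r = 0} with hZ
  have hfin : Z.Finite := by
    by_contra hinf
    have hsub : Z ⊆ Icc δ (t N) := fun r hr =>
      ⟨by by_contra! hlt; exact hv0 r ⟨hr.1.1, hlt⟩ hr.2, hr.1.2⟩
    obtain ⟨x, hx, hacc⟩ := Set.Infinite.exists_accPt_of_subset_isCompact hinf isCompact_Icc hsub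
    rw [accPt_iff_frequently_nhdsNE] at hacc
    have hx0 : 0 < x := hδ.trans_le hx.1
    have hd := hv x hx0
    have hvx : v x = 0 := by
      by_contra hne
      refine hacc ?_
      filter_upwards [nhdsWithin_le_nhds (hd.continuousAt.eventually_ne hne)] with r hr h
        using hr h.2
    refine hacc ?_
    filter_upwards [hd.eventually_ne (c := 0) (hsimple x ⟨hx0, hx.2⟩ hvx)] with r hr h using hr h.2
  have hzero : ∀ i, i < N → ∃ z ∈ Ioo (t i) (t (i + 1)), v z = 0 := by
    intro i hi
    have hlt := ht (Nat.lt_succ_self i)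
    have h1 := hsign i hi.le
    have h2 := hsign (i + 1) hi
    have h3 : (-1) ^ i * v (t (i + 1)) < 0 := by
      rw [pow_succ] at h2
      linarith
    have hcont : ContinuousOn (fun r => (-1) ^ i * v r) (Icc (t i) (t (i + 1))) := fun r hr =>
      ((hv r ((htpos i).trans_le hr.1)).continuousAt.const_mul _).continuousWithinAt
    obtain ⟨z, hz, hvz⟩ := intermediate_value_Ioo' hlt.le hcont ⟨h3, h1⟩
    exact ⟨z, hz, (mul_eq_zero.1 hvz).resolve_left (pow_ne_zero _ (by norm_num))⟩
  choose! z hz hvz using hzero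
  have hcard : N ≤ hfin.toFinset.card := by
    have hlt : ∀ i j, i < j → j < N → z i < z j := fun i j hij hj =>
      ((hz i (hij.trans hj)).2.trans_le (ht.monotone hij)).trans (hz j hj).1
    calc N = (Finset.range N).card := (Finset.card_range N).symm
      _ ≤ _ := by
        refine Finset.card_le_card_of_injOn z (fun i hi => ?_) fun i hi j hj hij => ?_
        · have hi' : i < N := by simpa using hi
          simp only [Finite.coe_toFinset]
          exact ⟨⟨(htpos i).trans (hz i hi').1, (hz i hi').2.le.trans (ht.monotone hi')⟩, hvz i hi'⟩
        · have hi' : i < N := by simpa using hi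
          have hj' : j < N := by simpa using hj
          rcases lt_trichotomy i j with h | h | h
          · exact absurd hij (hlt i j h hj').ne
          · exact h
          · exact absurd hij (hlt j i h hi').ne'
  obtain ⟨x, hxZ, hxN⟩ := hfin.toFinset.exists_card_filter_le_eq hN hcard
  have hx : x ∈ Z := hfin.mem_toFinset.1 hxZ
  refine ⟨x, hx.1.2, ⟨hx.1.1, hx.2, (hv x hx.1.1).eventually_ne (hsimple x hx.1 hx.2)⟩, ?_⟩
  have e : {r : ℝ | 0 < r ∧ r ≤ x ∧ v r = 0} = (hfin.toFinset.filter (· ≤ x) : Finset ℝ) := by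
    ext r
    simp only [mem_ofPred_eq, Finset.coe_filter, Finite.mem_toFinset, hZ, mem_Ioc]
    exact ⟨fun ⟨h1, h2, h3⟩ => ⟨⟨⟨h1, h2.trans hx.1.2⟩, h3⟩, h2⟩,
      fun ⟨⟨⟨h1, _⟩, h3⟩, h2⟩ => ⟨h1, h2, h3⟩⟩
  rw [e, Set.encard_coe_eq_coe_finsetCard, hxN]

/-- Up to the `N`-th zero there are finitely many zeros, so all of them are isolated. -/
lemma IsNthZero.le_encard_isIsolatedZero {v : ℝ → ℝ} {N : ℕ} {z : ℝ} (h : IsNthZero v N z) :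
    (N : ℕ∞) ≤ {r : ℝ | IsIsolatedZero v r}.encard := by
  rw [← h.2]
  refine Set.encard_le_encard fun r hr => ?_
  obtain ⟨h1, h2, h3⟩ := hr
  rcases h2.eq_or_lt with rfl | h2
  · exact h.1
  refine ⟨h1, h3, ?_⟩
  have hfin : {r : ℝ | 0 < r ∧ r ≤ z ∧ v r = 0}.Finite := Set.finite_of_encard_eq_coe h.2
  have hcl := (hfin.subset (sdiff_subset (t := {r}))).isClosed.compl_mem_nhds (x := r) (by simp)
  filter_upwards [self_mem_nhdsWithin, nhdsWithin_le_nhds hcl,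
    nhdsWithin_le_nhds (Ioo_mem_nhds h1 h2)] with s hs1 hs2 hs3 hs4
  exact hs2 ⟨⟨hs3.1, hs3.2.le, hs4⟩, hs1⟩

/-! ### Rescaling -/

section
variable {n k : ℕ} {q κ γ : ℝ} {v : ℝ → ℝ}

lemma IsRadialProfile.hasDerivAt (h : IsRadialProfile n k q κ γ v) {r : ℝ} (hr : 0 < r) :
    HasDerivAt v (deriv v r) r :=
  ((h.contDiffOn.differentiableOn one_ne_zero r hr.le).differentiableAt
    (Ici_mem_nhds hr)).hasDerivAt

lemma IsRadialProfile.tendsto_initial_value (h : IsRadialProfile n k q κ γ v) :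
    Tendsto v (𝓝[>] 0) (𝓝 γ) := by
  have := h.contDiffOn.continuousOn 0 (mem_Ici.2 le_rfl)
  rw [ContinuousWithinAt, h.initial_value] at this
  exact this.mono_left (nhdsWithin_mono _ Ioi_subset_Ici_self)

lemma IsRadialProfile.tendsto_initial_slope (h : IsRadialProfile n k q κ γ v) :
    Tendsto (deriv v) (𝓝[>] 0) (𝓝 0) := by
  have h1 := h.contDiffOn.continuousOn_derivWithin (uniqueDiffOn_Ici 0) le_rfl 0 (mem_Ici.2 le_rfl)
  rw [ContinuousWithinAt, h.initial_slope.derivWithin (uniqueDiffOn_Ici 0 0 (mem_Ici.2 le_rfl))]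
    at h1
  refine (h1.mono_left (nhdsWithin_mono _ Ioi_subset_Ici_self)).congr' ?_
  filter_upwards [self_mem_nhdsWithin] with r hr
  exact derivWithin_of_mem_nhds (Ici_mem_nhds hr)

/-- With the length scale `γ^{-(q-k)/(2k)}` and the amplitude `γ`, the terms `r v' + κ v` acquire
the factor `γ^{1-q}`, and the others keep their coefficients. -/
lemma IsRadialProfile.isScaledProfile (h : IsRadialProfile n k q κ γ v) (hk : Odd k) (hn : k < n)
    (hγ : 0 < γ) {l : ℝ} (hl : l = γ ^ (-((q - k) / (2 * k)))) :
    IsScaledProfile n k q (hessianConst n k)⁻¹ κ (γ ^ (1 - q)) (fun s => γ⁻¹ * v (l * s))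
      (fun s => γ⁻¹ * (l * deriv v (l * s))) := by
  have hk0 : (0 : ℝ) < k := by exact_mod_cast hk.pos
  have hl0 : 0 < l := hl ▸ Real.rpow_pos_of_pos hγ _
  have hlim : Tendsto (fun s => l * s) (𝓝[>] 0) (𝓝[>] 0) := by
    refine tendsto_nhdsWithin_iff.2 ⟨?_, ?_⟩
    · have : Tendsto (fun s => l * s) (𝓝 0) (𝓝 (l * 0)) := (continuous_const_mul l).tendsto 0
      rw [mul_zero] at this
      exact tendsto_nhdsWithin_of_tendsto_nhds this
    · filter_upwards [self_mem_nhdsWithin] with s hs using mul_pos hl0 hs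
  have hinner : ∀ s, HasDerivAt (fun s => l * s) l s := fun s => by
    simpa using (hasDerivAt_id s).const_mul l
  refine ⟨⟨fun s hs => ?_, fun s hs => ?_⟩, ?_, ?_⟩
  · refine (((h.hasDerivAt (mul_pos hl0 hs)).comp s (hinner s)).const_mul γ⁻¹).congr_deriv ?_
    ring
  · have h1 := ((h.equation _ (mul_pos hl0 hs)).comp s (hinner s)).const_mul
      (γ⁻¹ ^ k * l ^ k / l ^ (n - k))
    have e : (fun s => s ^ (n - k) * (γ⁻¹ * (l * deriv v (l * s))) ^ k) = fun s =>
        γ⁻¹ ^ k * l ^ k / l ^ (n - k) *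
          ((fun ρ : ℝ => ρ ^ (n - k) * (deriv v ρ) ^ k) ∘ fun s => l * s) s := by
      funext s
      have : l ^ (n - k) ≠ 0 := (pow_pos hl0 _).ne'
      simp only [Function.comp, mul_pow]
      field_simp
    rw [e]
    refine h1.congr_deriv ?_
    have habs : |γ⁻¹ * v (l * s)| ^ (q - 1) = γ ^ (1 - q) * |v (l * s)| ^ (q - 1) := by
      rw [abs_mul, abs_of_pos (inv_pos.2 hγ), Real.mul_rpow (inv_pos.2 hγ).le (abs_nonneg _),
        Real.inv_rpow hγ.le, ← Real.rpow_neg hγ.le, neg_sub]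
    have hpow : l ^ (2 * k) = γ ^ k * γ ^ (1 - q) * γ⁻¹ := by
      rw [hl, ← Real.rpow_natCast, ← Real.rpow_mul hγ.le, ← Real.rpow_natCast γ k,
        ← Real.rpow_neg_one γ, ← Real.rpow_add hγ, ← Real.rpow_add hγ]
      congr 1
      push_cast
      field_simp
      ring
    have hpow' : l ^ k / l ^ (n - k) * (l ^ (n - 1) * l) = l ^ (2 * k) := by
      have h2 : l ^ (n - 1) * l = l ^ (n - k) * l ^ k := by
        rw [← pow_succ, ← pow_add]
        congr 1
        omega
      have : l ^ (n - k) ≠ 0 := (pow_pos hl0 _).ne'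
      rw [h2, two_mul, pow_add]
      field_simp
    rw [radialForce, habs]
    generalize γ ^ (1 - q) = g at *
    generalize |v (l * s)| ^ (q - 1) = A at *
    generalize (hessianConst n k)⁻¹ = c at *
    have hγk : γ ^ k ≠ 0 := (pow_pos hγ _).ne'
    calc _ = -(γ⁻¹ ^ k * (l ^ k / l ^ (n - k) * (l ^ (n - 1) * l)) * s ^ (n - 1) *
          (l * s * deriv v (l * s) + κ * v (l * s) + c * A * v (l * s))) := by ring
      _ = _ := by
        rw [hpow', hpow, inv_pow]
        field_simp
  · have := (h.tendsto_initial_value.comp hlim).const_mul γ⁻¹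
    rwa [inv_mul_cancel₀ hγ.ne'] at this
  · have := ((h.tendsto_initial_slope.comp hlim).const_mul l).const_mul γ⁻¹
    simpa using this

end

/-! ### Zeros for large initial values -/

/-- For large `γ` every solution has an `N`-th zero, and it is small. A statement holds for all
solutions with `γ` large if it holds along every ultrafilter of pairs `(γ, v)` with `γ → ∞`; along
each of these the rescaled solutions converge, with sign changes that depend on the ultrafilter. -/
theorem exists_isNthZero_lt {n k : ℕ} {q : ℝ} (κ : ℝ) (hk : Odd k) (hn : 2 * k < n)
    (hkq : (k : ℝ) < q) (hsub : q * ((n : ℝ) - 2 * k) < ((n : ℝ) + 2) * k) {N : ℕ} (hN : 1 ≤ N)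
    {η : ℝ} (hη : 0 < η) :
    ∃ Γ : ℝ, 0 < Γ ∧ ∀ γ : ℝ, Γ < γ → ∀ v : ℝ → ℝ, IsRadialProfile n k q κ γ v →
      ∃ z : ℝ, IsNthZero v N z ∧ z < η := by
  have hk1 : (1 : ℝ) ≤ k := by exact_mod_cast hk.pos
  have hq : 1 < q := by linarith
  have hC : 0 < (hessianConst n k)⁻¹ := by
    have h1 : (0 : ℝ) < n.choose k := by exact_mod_cast Nat.choose_pos (by omega)
    have h2 : (0 : ℝ) < n := by exact_mod_cast (show 0 < n by omega)
    unfold hessianConst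
    positivity
  set F : Filter (ℝ × (ℝ → ℝ)) :=
    comap Prod.fst atTop ⊓ 𝓟 {x | IsRadialProfile n k q κ x.1 x.2} with hF
  suffices hmain : ∀ᶠ x in F, ∃ z : ℝ, IsNthZero x.2 N z ∧ z < η by
    rw [hF, eventually_inf_principal, eventually_comap] at hmain
    obtain ⟨a, ha⟩ := hmain.exists_forall_of_atTop
    exact ⟨max a 1, by positivity, fun γ hγ v hv =>
      ha γ ((le_max_left _ _).trans hγ.le) (γ, v) rfl hv⟩
  refine mem_iff_ultrafilter.2 fun l hl => ?_
  have hγ : Tendsto (Prod.fst : ℝ × (ℝ → ℝ) → ℝ) l atTop :=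
    tendsto_iff_comap.2 (hl.trans inf_le_left)
  have hprof : ∀ᶠ x in (l : Filter (ℝ × (ℝ → ℝ))), IsRadialProfile n k q κ x.1 x.2 :=
    le_principal_iff.1 (hl.trans inf_le_right)
  have hγ1 := hγ.eventually_ge_atTop 1
  have hε : Tendsto (fun x : ℝ × (ℝ → ℝ) => x.1 ^ (1 - q)) l (𝓝 0) := by
    have := (tendsto_rpow_neg_atTop (show 0 < q - 1 by linarith)).comp hγ
    simpa [Function.comp_def] using this
  have hσ0 : 0 < (q - k) / (2 * k) := div_pos (by linarith) (by linarith)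
  set σ : ℝ × (ℝ → ℝ) → ℝ := fun x => x.1 ^ (-((q - k) / (2 * k))) with hσ
  have hσlim : Tendsto σ l (𝓝 0) := (tendsto_rpow_neg_atTop hσ0).comp hγ
  have hscaled : ∀ᶠ x in (l : Filter (ℝ × (ℝ → ℝ))), IsScaledProfile n k q (hessianConst n k)⁻¹ κ
      (x.1 ^ (1 - q)) (fun s => x.1⁻¹ * x.2 (σ x * s))
      (fun s => x.1⁻¹ * (σ x * deriv x.2 (σ x * s))) := by
    filter_upwards [hprof, hγ1] with x hx hx1
    exact hx.isScaledProfile hk (by omega) (by linarith) rfl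
  obtain ⟨W, Q, hWQ, hW, hQ, δ, hδ, hnear⟩ := exists_limit_profile l hk (by omega) hq hC κ hε
    (by filter_upwards [hγ1] with x hx using
      ⟨by positivity, Real.rpow_le_one_of_one_le_of_nonpos hx (by linarith)⟩) hscaled
  obtain ⟨t, ht0, ht, hsign⟩ := hWQ.exists_alternating hk hn hkq hC hsub
  have htpos : ∀ i, 0 < t i := fun i => ht0.trans_le (ht.monotone (Nat.zero_le i))
  have hsign' : ∀ᶠ x in (l : Filter (ℝ × (ℝ → ℝ))), ∀ i ∈ Finset.range (N + 1),
      0 < (-1) ^ i * (x.1⁻¹ * x.2 (σ x * t i)) := by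
    refine (eventually_all_finset _).2 fun i _ => ?_
    have h1 : Tendsto (fun x : ℝ × (ℝ → ℝ) => x.1⁻¹ * x.2 (σ x * t i)) l (𝓝 (W (t i))) :=
      (hW (t i) (htpos i)).comp (tendsto_id.prodMk (tendsto_const_pure.mono_right (pure_le_nhds _)))
    exact (h1.const_mul _).eventually (lt_mem_nhds (hsign i))
  have hsimple : ∀ᶠ x in (l : Filter (ℝ × (ℝ → ℝ))), ∀ s ∈ Icc (δ / 2) (t N),
      (x.1⁻¹ * x.2 (σ x * s), x.1⁻¹ * (σ x * deriv x.2 (σ x * s))) ≠ (0, 0) := by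
    have h1 := (isCompact_Icc (a := δ / 2) (b := t N)).mem_prod_nhdsSet_of_forall
      (l := (l : Filter (ℝ × (ℝ → ℝ)))) (s := {z | (z.1.1⁻¹ * z.1.2 (σ z.1 * z.2),
        z.1.1⁻¹ * (σ z.1 * deriv z.1.2 (σ z.1 * z.2))) ≠ (0, 0)}) fun s hs => by
      have hs0 : 0 < s := by linarith [hs.1]
      exact ((hW s hs0).prodMk_nhds (hQ s hs0)).eventually_ne
        (hWQ.ne_zero_or_ne_zero hk hn hq hC hsub hs0)
    filter_upwards [Eventually.curry h1] with x hx using hx.self_of_nhdsSet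
  have hsmall : ∀ᶠ x in (l : Filter (ℝ × (ℝ → ℝ))), σ x * t N < η := by
    have := hσlim.mul_const (t N)
    rw [zero_mul] at this
    exact this.eventually (gt_mem_nhds hη)
  filter_upwards [hprof, hγ1, hnear, hsign', hsimple, hsmall] with x hx hx1 h1 h2 h3 h4
  have hx0 : 0 < x.1 := by linarith
  have hσx : 0 < σ x := Real.rpow_pos_of_pos hx0 _
  have hrescale : ∀ r, σ x * (r / σ x) = r := fun r => mul_div_cancel₀ r hσx.ne'
  have hnear' : ∀ r ∈ Ioo 0 (σ x * δ), x.2 r ≠ 0 := by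
    intro r hr h0
    have := h1 (r / σ x) ⟨div_pos hr.1 hσx, (div_lt_iff₀' hσx).2 hr.2⟩
    rw [hrescale, h0, mul_zero] at this
    linarith
  obtain ⟨z, hz, hzN⟩ := exists_isNthZero (fun r hr => hx.hasDerivAt hr) hN
    (t := fun i => σ x * t i) (mul_pos hσx ht0) (fun i j hij => mul_lt_mul_of_pos_left (ht hij) hσx)
    (fun i hi => by
      have := h2 i (Finset.mem_range.2 (by omega))
      rw [mul_left_comm] at this
      exact pos_of_mul_pos_right this (inv_pos.2 hx0).le) (mul_pos hσx hδ) hnear' (by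
      intro r hr h0 h0'
      refine h3 (r / σ x) ⟨?_, (div_le_iff₀' hσx).2 hr.2⟩ ?_
      · by_contra! hlt
        rw [div_lt_iff₀' hσx] at hlt
        exact hnear' r ⟨hr.1, hlt.trans (by nlinarith)⟩ h0
      · rw [hrescale, h0, h0', mul_zero, mul_zero, mul_zero])
  exact ⟨z, hzN, hz.trans_lt h4⟩

theorem proposition3p1 (n k : ℕ) (q κ : ℝ) (hk : Odd k) (hn : 2 * k < n)
    (hkq : (k : ℝ) < q) (hq : (q : EReal) < criticalExponent n k) :
    (∀ N : ℕ, ∃ γN : ℝ, 0 < γN ∧ ∀ γ : ℝ, γN < γ →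
      ∀ v : ℝ → ℝ, IsRadialProfile n k q κ γ v →
        (N : ℕ∞) < {r : ℝ | IsIsolatedZero v r}.encard) ∧
    (∀ N : ℕ, 1 ≤ N → ∀ ε : ℝ, 0 < ε → ∃ Γ : ℝ, 0 < Γ ∧ ∀ γ : ℝ, Γ < γ →
      ∀ v : ℝ → ℝ, IsRadialProfile n k q κ γ v →
        ∃ z : ℝ, IsNthZero v N z ∧ z < ε) := by
  have hsub : q * ((n : ℝ) - 2 * k) < ((n : ℝ) + 2) * k := by
    have h1 : (0 : ℝ) < (n : ℝ) - 2 * k := sub_pos.2 (by exact_mod_cast hn)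
    rw [criticalExponent, if_pos hn, EReal.coe_lt_coe_iff, lt_div_iff₀ h1] at hq
    exact hq
  refine ⟨fun N => ?_, fun N hN ε hε => exists_isNthZero_lt κ hk hn hkq hsub hN hε⟩
  obtain ⟨Γ, hΓ, h⟩ := exists_isNthZero_lt κ hk hn hkq hsub (Nat.le_add_left 1 N) one_pos
  refine ⟨Γ, hΓ, fun γ hγ v hv => ?_⟩
  obtain ⟨z, hz, -⟩ := h γ hγ v hv
  exact lt_of_lt_of_le (by exact_mod_cast Nat.lt_succ_self N) hz.le_encard_isIsolatedZero
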